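/- Let $(\Omega,\mathcal F,\mathbf P)$ be a probability space carrying a stationary Markov process $(X_t)_{t\in\mathbb R}$ with càdlàg sample paths in a Polish space $E$, with stationary law $\pi=\mathbf P(X_0\in\cdot)$, and an $n$-dimensional two-sided Wiener process $(B_t)_{t\in\mathbb R}$ independent of $(X_t)_{t\in\mathbb R}$. Let $h:E\to\mathbb R^n$ be a Borel function such that almost surely $s\mapsto h(X_s)$ is locally integrable on $\mathbb R$. For $\kappa\ge 0$ put $$Y^\kappa_t=\int_0^t h(X_s)\,ds+\kappa B_t\quad(t\in\mathbb R),\qquad \mathcal F^{Y,\kappa}_{]-\infty,0]}=\bigvee_{a<0}\sigma\{Y^\kappa_s-Y^\kappa_a: s\in[a,0]\},\qquad \mathcal F^{h(X)}_{]-\infty,0]}=\sigma\{h(X_s):s\le 0\},$$ and, for $f:E\to\mathbb R$ with $\int f^2\,d\pi<\infty$, $$e(f,\kappa)=\mathbf E\Big(\big\{f(X_0)-\mathbf E\big(f(X_0)\,\big|\,\mathcal F^{Y,\kappa}_{]-\infty,0]}\big)\big\}^2\Big).$$ Then for every $f$ with $\int f^2\,d\pi<\infty$, $$\lim_{\kappa\downarrow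 0}e(f,\kappa)=e(f,0)=e(f):=\mathbf E\Big(\big\{f(X_0)-\mathbf E\big(f(X_0)\,\big|\,\mathcal F^{h(X)}_{]-\infty,0]}\big)\big\}^2\Big).$$ -/

import Mathlib

open MeasureTheory ProbabilityTheory Filter Topology
open scoped NNReal

noncomputable section

namespace FilterAccuracy

variable {Ω E : Type*} {n : ℕ}

/-- The σ-field `σ{X_s : s ∈ I}` generated by a process over the time set `I`. -/
def sigmaOn {F : Type*} [MeasurableSpace F] (X : ℝ → Ω → F) (I : Set ℝ) : MeasurableSpace Ω :=
  ⨆ s ∈ I, MeasurableSpace.comap (X s) inferInstance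

/-- `(X_t)_{t ∈ ℝ}` is a stationary Markov process with càdlàg sample paths. -/
structure IsStationaryMarkovCadlag [MeasurableSpace Ω] [TopologicalSpace E] [MeasurableSpace E]
    (X : ℝ → Ω → E) (P : Measure Ω) : Prop where
  /-- every `X_t` is a random variable -/
  measurable : ∀ t, Measurable (X t)
  /-- sample paths are right continuous -/
  right_cont : ∀ ω t, ContinuousWithinAt (fun s => X s ω) (Set.Ici t) t
  /-- sample paths have left limits -/
  left_lim : ∀ ω t, ∃ x, Tendsto (fun s => X s ω) (𝓝[<] t) (𝓝 x)
  /-- the law of the whole process is invariant under time shifts -/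
  stationary : ∀ r : ℝ, IdentDistrib (fun ω t => X (t + r) ω) (fun ω t => X t ω) P P
  /-- Markov property: given the past up to `s`, the law of `X_t` depends on `X_s` only -/
  markov : ∀ s t : ℝ, s ≤ t → ∀ A : Set E, MeasurableSet A →
    P⟦X t ⁻¹' A | sigmaOn X (Set.Iic s)⟧ =ᵐ[P] P⟦X t ⁻¹' A | sigmaOn X {s}⟧

/-- The one-sided branches of the coordinates of a process indexed by `ℝ`: for `p = (i, true)` the
process `t ↦ B^i_t`, for `p = (i, false)` the process `t ↦ B^i_{-t}`, where `t ≥ 0`. -/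
def branch (B : ℝ → Ω → EuclideanSpace ℝ (Fin n)) (p : Fin n × Bool) (t : ℝ≥0) (ω : Ω) : ℝ :=
  B (if p.2 then (t : ℝ) else -(t : ℝ)) ω p.1

/-- `(B_t)_{t ∈ ℝ}` is an `n`-dimensional two-sided Wiener process: the `2n` processes
`(B^i_t)_{t ≥ 0}` and `(B^i_{-t})_{t ≥ 0}` are independent standard Brownian motions. -/
structure IsTwoSidedWiener [MeasurableSpace Ω] (B : ℝ → Ω → EuclideanSpace ℝ (Fin n))
    (P : Measure Ω) : Prop where
  measurable : ∀ t, Measurable (B t)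
  brownian : ∀ p : Fin n × Bool, IsBrownianReal (branch B p) P
  indep : iIndepFun (fun (p : Fin n × Bool) (ω : Ω) (t : ℝ≥0) => branch B p t ω) P

/-- The observation process `Y_t^κ = ∫_0^t h(X_s) ds + κ B_t`. -/
def obs (X : ℝ → Ω → E) (B : ℝ → Ω → EuclideanSpace ℝ (Fin n))
    (h : E → EuclideanSpace ℝ (Fin n)) (κ : ℝ) (t : ℝ) (ω : Ω) : EuclideanSpace ℝ (Fin n) :=
  (∫ s in (0 : ℝ)..t, h (X s ω)) + κ • B t ω

/-- `σ{Y_s - Y_a : s ∈ [a, b]}`. -/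
def incrSigma (Y : ℝ → Ω → EuclideanSpace ℝ (Fin n)) (a b : ℝ) : MeasurableSpace Ω :=
  sigmaOn (fun s ω => Y s ω - Y a ω) (Set.Icc a b)

/-- `⋁_{a < b} σ{Y_s - Y_a : s ∈ [a, b]}`, the observations on `]-∞, b]`. -/
def pastIncrSigma (Y : ℝ → Ω → EuclideanSpace ℝ (Fin n)) (b : ℝ) : MeasurableSpace Ω :=
  ⨆ a ∈ Set.Iio b, incrSigma Y a b

/-- The mean square error `E({Z - E(Z | 𝒢)}²)` of the conditional expectation given `𝒢`. -/
def condError [MeasurableSpace Ω] (P : Measure Ω) (Z : Ω → ℝ) (𝒢 : MeasurableSpace Ω) : ℝ :=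
  ∫ ω, (Z ω - (P[Z | 𝒢]) ω) ^ 2 ∂P

/-- The stationary filtering error `e(f, κ)`: the error of estimating `f(X_0)` from the
observations `Y^κ` on `]-∞, 0]`. -/
def filterError [MeasurableSpace Ω] (P : Measure Ω) (X : ℝ → Ω → E)
    (B : ℝ → Ω → EuclideanSpace ℝ (Fin n)) (h : E → EuclideanSpace ℝ (Fin n))
    (f : E → ℝ) (κ : ℝ) : ℝ :=
  condError P (fun ω => f (X 0 ω)) (pastIncrSigma (obs X B h κ) 0)

/-- The noiseless error `e(f)`: the error of estimating `f(X_0)` from `h(X_s)`, `s ≤ 0`. -/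
def noiselessError [MeasurableSpace Ω] (P : Measure Ω) (X : ℝ → Ω → E)
    (h : E → EuclideanSpace ℝ (Fin n)) (f : E → ℝ) : ℝ :=
  condError P (fun ω => f (X 0 ω)) (sigmaOn (fun s ω => h (X s ω)) (Set.Iic 0))

end FilterAccuracy

end

/-!
Write `𝒢_κ` for the σ-field of the past increments of `Y^κ`, `ℋ` for that of `h(X_s)`, `s ≤ 0`, and
measure errors by the `L²` distance from `f(X_0)` to its conditional expectation, which is its best
approximation in `L²` (`eLpNorm_sub_condExp_le`).

Both claims rest on one semicontinuity principle. Call an event asymptotically measurable along a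
family of σ-fields if these contain events close to it in probability; such events form a σ-field
`asympSigma`, and it contains everything generated by limits in probability of measurable random
variables (`comap_le_asympSigma`). If all events of `𝒢` are asymptotically measurable, then in the
limit the error along the family is at most the error given `𝒢` (`eventually_error_le`), because
`E(Z | 𝒢)` is an `L²` limit of simple functions. For a constant family this compares two σ-fields up
to null sets.

* `limsup e(f, κ) ≤ e(f, 0)`: the increments of `Y^κ` converge to those of `Y^0` as `κ → 0`.
* `e(f, 0) ≤ e(f, κ)`: `Y^κ` is a function of `Y^0` and `B`, and `B` is independent of `X`, so that
  conditioning on `B` in addition to `Y^0` changes nothing (`condExp_sup_of_indep`).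
* `e(f) ≤ e(f, 0)`: time integrals of `h(X_s)` are `ℋ`-measurable up to null sets. For bounded
  integrands, Fubini shows that such an integral `V` is orthogonal to `V - E(V | ℋ)`
  (`aestronglyMeasurable_integral_of_bounded`); truncation gives the general case.
* `e(f, 0) ≤ e(f)`: by Lebesgue's differentiation theorem and Fubini, `h(X_t)` is `𝒢_0`-measurable up
  to null sets for almost every `t ≤ 0`. Stationarity and right continuity of the paths make
  `P({X_s ∈ A} ∆ {X_t ∈ A})` tend to zero as `s ↑ t` for every Borel set `A`, which extends this to
  every `t ≤ 0` (`sigmaOn_le_asympSigma`).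
-/

namespace FilterAccuracy

open scoped ENNReal symmDiff

/-! ### Conditional expectation as best approximation -/

theorem eLpNorm_two_toReal_sq {Ω : Type*} {m0 : MeasurableSpace Ω} {P : Measure Ω} {V : Ω → ℝ}
    (hV : MemLp V 2 P) : (eLpNorm V 2 P).toReal ^ 2 = ∫ ω, V ω ^ 2 ∂P := by
  have h0 : (0 : ℝ) ≤ ∫ ω, V ω ^ 2 ∂P := integral_nonneg fun ω => sq_nonneg _
  rw [hV.eLpNorm_eq_integral_rpow_norm two_ne_zero ENNReal.ofNat_ne_top]
  have : (∫ a, ‖V a‖ ^ (2 : ℝ≥0∞).toReal ∂P) = ∫ ω, V ω ^ 2 ∂P := by simp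
  rw [this, ENNReal.toReal_ofReal (by positivity), ENNReal.toReal_ofNat, ← Real.rpow_natCast,
    ← Real.rpow_mul h0]
  norm_num

theorem condError_eq_eLpNorm {Ω : Type*} {m0 : MeasurableSpace Ω} {P : Measure Ω} {Z : Ω → ℝ}
    (hZ : MemLp Z 2 P) (𝒢 : MeasurableSpace Ω) :
    @condError Ω m0 P Z 𝒢 = (eLpNorm (Z - P[Z | 𝒢]) 2 P).toReal ^ 2 :=
  (eLpNorm_two_toReal_sq (hZ.sub (hZ.condExp one_le_two))).symm

/-- The conditional expectation is the best square integrable approximation among the functions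
that are measurable for the sub-σ-field, up to null sets. -/
theorem eLpNorm_sub_condExp_le {Ω : Type*} {m0 : MeasurableSpace Ω} {P : Measure Ω}
    [IsProbabilityMeasure P] {𝒢 : MeasurableSpace Ω} (h𝒢 : 𝒢 ≤ m0) {Z U : Ω → ℝ}
    (hZ : MemLp Z 2 P) (hU : MemLp U 2 P) (hUm : AEStronglyMeasurable[𝒢] U P) :
    eLpNorm (Z - P[Z | 𝒢]) 2 P ≤ eLpNorm (Z - U) 2 P := by
  have hV : MemLp (Z - U) 2 P := hZ.sub hU
  have hcong : Z - P[Z | 𝒢] =ᵐ[P] (Z - U) - P[Z - U | 𝒢] := by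
    filter_upwards [condExp_sub (hZ.integrable one_le_two) (hU.integrable one_le_two) 𝒢,
      condExp_of_aestronglyMeasurable' h𝒢 hUm (hU.integrable one_le_two)] with ω h1 h2
    simp only [Pi.sub_apply] at h1 ⊢
    rw [h1, h2]
    ring
  have hVE : MemLp (Z - U - P[Z - U | 𝒢]) 2 P := hV.sub (hV.condExp one_le_two)
  rw [eLpNorm_congr_ae hcong, ← ENNReal.toReal_le_toReal hVE.2.ne hV.2.ne,
    ← sq_le_sq₀ ENNReal.toReal_nonneg ENNReal.toReal_nonneg, eLpNorm_two_toReal_sq hVE,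
    eLpNorm_two_toReal_sq hV]
  have h1 := integral_mono_ae integrable_condVar integrable_condExp
    (condVar_ae_le_condExp_sq h𝒢 hV)
  rw [condVar, integral_condExp h𝒢, integral_condExp h𝒢] at h1
  exact h1

/-- A larger σ-field gives a smaller error. -/
theorem eLpNorm_sub_condExp_anti {Ω : Type*} {m0 : MeasurableSpace Ω} {P : Measure Ω}
    [IsProbabilityMeasure P] {𝒢 ℋ : MeasurableSpace Ω} (h : 𝒢 ≤ ℋ) (hℋ : ℋ ≤ m0) {Z : Ω → ℝ}
    (hZ : MemLp Z 2 P) :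
    eLpNorm (Z - P[Z | ℋ]) 2 P ≤ eLpNorm (Z - P[Z | 𝒢]) 2 P :=
  eLpNorm_sub_condExp_le hℋ hZ (hZ.condExp one_le_two)
    (stronglyMeasurable_condExp.mono h).aestronglyMeasurable

/-- Enlarging the σ-field `𝒢` by an independent σ-field `𝒦` does not change a conditional
expectation. Here `ℳ` contains both `𝒢` and the information in `Z`, and is independent of `𝒦`. -/
theorem condExp_sup_of_indep {Ω : Type*} {m0 : MeasurableSpace Ω} {P : Measure Ω}
    [IsProbabilityMeasure P] {𝒢 ℳ 𝒦 : MeasurableSpace Ω} (hℳ : ℳ ≤ m0) (h𝒦 : 𝒦 ≤ m0)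
    (h𝒢ℳ : 𝒢 ≤ ℳ) (hind : Indep ℳ 𝒦 P) {Z : Ω → ℝ} (hZ : Integrable Z P)
    (hZm : StronglyMeasurable[ℳ] Z) : P[Z | 𝒢] =ᵐ[P] P[Z | 𝒢 ⊔ 𝒦] := by
  have h𝒢 : 𝒢 ≤ m0 := h𝒢ℳ.trans hℳ
  have hsup : 𝒢 ⊔ 𝒦 ≤ m0 := sup_le h𝒢 h𝒦
  refine ae_eq_condExp_of_forall_setIntegral_eq hsup hZ
    (fun s _ _ => integrable_condExp.integrableOn) ?_
    (stronglyMeasurable_condExp.mono le_sup_left).aestronglyMeasurable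
  have hD : Integrable (P[Z | 𝒢] - Z) P := integrable_condExp.sub hZ
  have key : ∀ W : Ω → ℝ, Integrable W P → StronglyMeasurable[ℳ] W → ∀ B, MeasurableSet[𝒦] B →
      ∫ ω in B, W ω ∂P = P.real B * ∫ ω, W ω ∂P := by
    intro W hW hWm B hB
    have hle : MeasurableSpace.comap W inferInstance ≤ ℳ := hWm.measurable.comap_le
    exact Indep.setIntegral_eq_mul (f := fun x => x) h𝒦 (indep_of_indep_of_le_left hind hle).symm
      (hWm.mono hℳ).measurable.aemeasurable hB aestronglyMeasurable_id
  suffices H : ∀ S : Set (Ω × Ω), MeasurableSet[𝒢.prod 𝒦] S →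
      ∫ ω in (fun ω => (ω, ω)) ⁻¹' S, (P[Z | 𝒢] - Z) ω ∂P = 0 by
    intro s hs _
    have hs' : MeasurableSet[(𝒢.prod 𝒦).comap fun ω => (ω, ω)] s := by
      rw [MeasurableSpace.prod, MeasurableSpace.comap_sup, MeasurableSpace.comap_comp,
        MeasurableSpace.comap_comp]
      change MeasurableSet[𝒢.comap id ⊔ 𝒦.comap id] s
      rwa [@MeasurableSpace.comap_id Ω 𝒢, @MeasurableSpace.comap_id Ω 𝒦]
    obtain ⟨S, hS, rfl⟩ := hs'
    have := H S hS
    simp only [Pi.sub_apply] at this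
    rw [integral_sub integrable_condExp.integrableOn hZ.integrableOn] at this
    linarith
  have hmeas : ∀ S : Set (Ω × Ω), MeasurableSet[𝒢.prod 𝒦] S →
      MeasurableSet[m0] ((fun ω => (ω, ω)) ⁻¹' S) := fun S hS =>
    (@Measurable.prodMk Ω m0 Ω Ω 𝒢 𝒦 _ _ (measurable_id'' h𝒢) (measurable_id'' h𝒦)) hS
  intro S hS
  have hgen : 𝒢.prod 𝒦 = MeasurableSpace.generateFrom
      (Set.image2 (· ×ˢ ·) {s | MeasurableSet[𝒢] s} {t | MeasurableSet[𝒦] t}) :=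
    (@generateFrom_prod Ω Ω 𝒢 𝒦).symm
  induction S, hS using MeasurableSpace.induction_on_inter hgen
    (@isPiSystem_prod Ω Ω 𝒢 𝒦) with
  | empty => simp
  | basic t ht =>
    obtain ⟨A, hA, B, hB, rfl⟩ := ht
    have hA : MeasurableSet[𝒢] A := hA
    have hB : MeasurableSet[𝒦] B := hB
    have hpre : (fun ω => (ω, ω)) ⁻¹' (A ×ˢ B) = A ∩ B := rfl
    have hDm : StronglyMeasurable[ℳ] (A.indicator (P[Z | 𝒢] - Z)) :=
      ((stronglyMeasurable_condExp.mono h𝒢ℳ).sub hZm).indicator (h𝒢ℳ _ hA)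
    rw [hpre, Set.inter_comm, ← setIntegral_indicator (h𝒢 _ hA),
      key _ (hD.indicator (h𝒢 _ hA)) hDm B hB, integral_indicator (h𝒢 _ hA)]
    simp only [Pi.sub_apply]
    rw [integral_sub integrable_condExp.integrableOn hZ.integrableOn,
      setIntegral_condExp h𝒢 hZ hA, sub_self, mul_zero]
  | compl t ht ih =>
    have := integral_add_compl (hmeas t ht) hD
    rw [ih, zero_add] at this
    rw [Set.preimage_compl, this]
    simp only [Pi.sub_apply]
    rw [integral_sub integrable_condExp hZ, integral_condExp h𝒢, sub_self]
  | iUnion g hdisj hg ih =>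
    rw [Set.preimage_iUnion, integral_iUnion (fun i => hmeas _ (hg i))
      (fun i j hij => (hdisj hij).preimage _) hD.integrableOn]
    simp_rw [ih, tsum_zero]

/-! ### Sets that are asymptotically measurable along a family of σ-fields -/

/-- The σ-field of the events `A` that can be approximated in probability, along the filter `l`, by
events of the σ-fields `ℋ k`. For a constant family and a nontrivial filter, these are the events
that agree with an event of that σ-field up to a null set. -/
@[reducible]
def asympSigma {Ω ι : Type*} {m0 : MeasurableSpace Ω} (P : Measure Ω) [IsFiniteMeasure P]
    (l : Filter ι) (ℋ : ι → MeasurableSpace Ω) : MeasurableSpace Ω where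
  MeasurableSet' A := MeasurableSet[m0] A ∧
    ∀ ε : ℝ≥0∞, ε ≠ 0 → ∀ᶠ k in l, ∃ A', MeasurableSet[ℋ k] A' ∧ P (A ∆ A') ≤ ε
  measurableSet_empty :=
    ⟨MeasurableSet.empty, fun ε _ => Eventually.of_forall fun k =>
      ⟨∅, @MeasurableSet.empty Ω (ℋ k), by simp⟩⟩
  measurableSet_compl A hA := by
    refine ⟨hA.1.compl, fun ε hε => ?_⟩
    filter_upwards [hA.2 ε hε] with k ⟨A', hA', hP⟩
    exact ⟨A'ᶜ, @MeasurableSet.compl Ω A' (ℋ k) hA', by rwa [compl_symmDiff_compl]⟩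
  measurableSet_iUnion A hA := by
    refine ⟨MeasurableSet.iUnion fun i => (hA i).1, fun ε hε => ?_⟩
    have hε2 : ε / 2 ≠ 0 := (ENNReal.half_pos hε).ne'
    -- a finite union already exhausts the countable one up to `ε / 2`
    have hlim : Tendsto (fun N => P ((⋃ i, A i) \ Set.accumulate A N)) atTop (𝓝 0) := by
      have hanti : Antitone fun N => (⋃ i, A i) \ Set.accumulate A N := fun a b hab =>
        Set.sdiff_subset_sdiff_right (Set.monotone_accumulate hab)
      have := tendsto_measure_iInter_atTop (μ := P)
        (s := fun N => (⋃ i, A i) \ Set.accumulate A N)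
        (fun N => ((MeasurableSet.iUnion fun i => (hA i).1).diff
          (MeasurableSet.biUnion (Set.to_countable _) fun i _ => (hA i).1)).nullMeasurableSet)
        hanti ⟨0, measure_ne_top _ _⟩
      rwa [← Set.sdiff_iUnion, Set.iUnion_accumulate, Set.sdiff_self, measure_empty] at this
    obtain ⟨N, hN⟩ := (hlim.eventually (ge_mem_nhds (pos_iff_ne_zero.2 hε2))).exists
    have hεN : ε / 2 / (N + 1 : ℕ) ≠ 0 := ENNReal.div_ne_zero.2 ⟨hε2, ENNReal.natCast_ne_top _⟩
    have hall : ∀ᶠ k in l, ∀ i ∈ Finset.range (N + 1),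
        ∃ A', MeasurableSet[ℋ k] A' ∧ P (A i ∆ A') ≤ ε / 2 / (N + 1 : ℕ) :=
      (Filter.eventually_all_finset _).2 fun i _ => (hA i).2 _ hεN
    filter_upwards [hall] with k hk
    choose! A' hA' hP using hk
    refine ⟨⋃ i ∈ Finset.range (N + 1), A' i,
      @Finset.measurableSet_biUnion _ _ (ℋ k) _ _ hA', ?_⟩
    have hsub : (⋃ i, A i) ∆ (⋃ i ∈ Finset.range (N + 1), A' i) ⊆
        ((⋃ i, A i) \ Set.accumulate A N) ∪ ⋃ i ∈ Finset.range (N + 1), A i ∆ A' i := by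
      intro ω hω
      simp only [Set.mem_symmDiff, Set.mem_union, Set.mem_iUnion, Set.mem_sdiff,
        Set.mem_accumulate, Finset.mem_range, Nat.lt_succ_iff, exists_prop] at hω ⊢
      grind
    calc P _ ≤ P ((⋃ i, A i) \ Set.accumulate A N)
          + P (⋃ i ∈ Finset.range (N + 1), A i ∆ A' i) :=
          (measure_mono hsub).trans (measure_union_le _ _)
      _ ≤ ε / 2 + ∑ i ∈ Finset.range (N + 1), P (A i ∆ A' i) := by
          gcongr
          exact measure_biUnion_finset_le _ _
      _ ≤ ε / 2 + ∑ i ∈ Finset.range (N + 1), ε / 2 / (N + 1 : ℕ) := by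
          gcongr with i hi
          exact hP i hi
      _ = ε := by
          rw [Finset.sum_const, Finset.card_range, nsmul_eq_mul,
            ENNReal.mul_div_cancel (by positivity) (ENNReal.natCast_ne_top _),
            ENNReal.add_halves]

theorem asympSigma_le {Ω ι : Type*} {m0 : MeasurableSpace Ω} (P : Measure Ω) [IsFiniteMeasure P]
    (l : Filter ι) (ℋ : ι → MeasurableSpace Ω) : asympSigma P l ℋ ≤ m0 := fun _ hA => hA.1

/-- A limit in probability of random variables measurable for the `ℋ k` generates a σ-field of
asymptotically measurable events. -/
theorem comap_le_asympSigma {Ω ι F : Type*} {m0 : MeasurableSpace Ω} {P : Measure Ω}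
    [IsFiniteMeasure P] {l : Filter ι} {ℋ : ι → MeasurableSpace Ω}
    [PseudoMetricSpace F] [MeasurableSpace F] [BorelSpace F] {U : ι → Ω → F} {ξ : Ω → F}
    (hξ : Measurable ξ) (hU : ∀ k, AEStronglyMeasurable[ℋ k] (U k) P)
    (hlim : TendstoInMeasure P U l ξ) :
    MeasurableSpace.comap ξ inferInstance ≤ asympSigma P l ℋ := by
  rw [BorelSpace.measurable_eq (α := F), borel_eq_generateFrom_isClosed,
    MeasurableSpace.comap_generateFrom]
  refine MeasurableSpace.generateFrom_le ?_
  rintro _ ⟨C, hC, rfl⟩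
  have hC : IsClosed C := hC
  refine ⟨hξ hC.measurableSet, fun ε hε => ?_⟩
  have hε2 : ε / 2 ≠ 0 := (ENNReal.half_pos hε).ne'
  -- a closed thickening of `C` that costs at most `ε / 2` in probability
  obtain ⟨δ, hδ, hδC⟩ : ∃ δ : ℝ, 0 < δ ∧
      P (ξ ⁻¹' Metric.cthickening (2 * δ) C \ ξ ⁻¹' C) ≤ ε / 2 := by
    have h1 := tendsto_measure_cthickening_of_isClosed (μ := P.map ξ)
      ⟨1, one_pos, measure_ne_top _ _⟩ hC
    have h2 : (P.map ξ) C < (P.map ξ) C + ε / 2 :=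
      ENNReal.lt_add_right (measure_ne_top _ _) hε2
    have h3 : Tendsto (fun δ : ℝ => 2 * δ) (𝓝[>] 0) (𝓝 0) := by
      have : Tendsto (fun δ : ℝ => 2 * δ) (𝓝 0) (𝓝 (2 * 0)) := tendsto_id.const_mul 2
      rw [mul_zero] at this
      exact this.mono_left nhdsWithin_le_nhds
    obtain ⟨δ, hδ1, hδ2⟩ := (((h1.comp h3).eventually (ge_mem_nhds h2)).and
      self_mem_nhdsWithin).exists
    refine ⟨δ, hδ2, ?_⟩
    simp only [Function.comp_apply] at hδ1
    rw [Measure.map_apply hξ hC.measurableSet,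
      Measure.map_apply hξ Metric.isClosed_cthickening.measurableSet] at hδ1
    rw [measure_sdiff (Set.preimage_mono (Metric.self_subset_cthickening C))
      (hξ hC.measurableSet).nullMeasurableSet (measure_ne_top _ _)]
    exact tsub_le_iff_left.2 hδ1
  filter_upwards [(hlim (ENNReal.ofReal δ) (ENNReal.ofReal_pos.2 hδ)).eventually
    (ge_mem_nhds (pos_iff_ne_zero.2 hε2))] with k hk
  set V := (hU k).mk (U k)
  have hV : StronglyMeasurable[ℋ k] V := (hU k).stronglyMeasurable_mk
  have hVU : U k =ᵐ[P] V := (hU k).ae_eq_mk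
  refine ⟨V ⁻¹' Metric.cthickening δ C, hV.measurable Metric.isClosed_cthickening.measurableSet, ?_⟩
  have hsub : (ξ ⁻¹' C) ∆ (V ⁻¹' Metric.cthickening δ C) ≤ᵐ[P]
      ((ξ ⁻¹' Metric.cthickening (2 * δ) C \ ξ ⁻¹' C) ∪
        {ω | ENNReal.ofReal δ ≤ edist (U k ω) (ξ ω)} : Set Ω) := by
    filter_upwards [hVU] with ω hω hmem
    have hmem : ω ∈ (ξ ⁻¹' C) ∆ (V ⁻¹' Metric.cthickening δ C) := hmem
    change ω ∈ ((ξ ⁻¹' Metric.cthickening (2 * δ) C \ ξ ⁻¹' C) ∪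
        {ω | ENNReal.ofReal δ ≤ edist (U k ω) (ξ ω)} : Set Ω)
    simp only [Set.mem_symmDiff, Set.mem_preimage, Set.mem_union, Set.mem_sdiff, Set.mem_ofPred_eq,
      Metric.mem_cthickening_iff] at hmem ⊢
    rw [← hω] at hmem
    by_contra hcon
    push Not at hcon
    obtain ⟨hc1, hc2⟩ := hcon
    rcases hmem with ⟨h1, h2⟩ | ⟨h1, h2⟩
    · exact h2 ((Metric.infEDist_le_edist_of_mem h1).trans hc2.le)
    · refine h2 (hc1 ?_)
      calc Metric.infEDist (ξ ω) C ≤ Metric.infEDist (U k ω) C + edist (ξ ω) (U k ω) :=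
            Metric.infEDist_le_infEDist_add_edist
        _ ≤ ENNReal.ofReal δ + ENNReal.ofReal δ := by
            gcongr
            rw [edist_comm]
            exact hc2.le
        _ = ENNReal.ofReal (2 * δ) := by rw [← ENNReal.ofReal_add hδ.le hδ.le, two_mul]
  calc P _ ≤ P _ := measure_mono_ae hsub
    _ ≤ _ := measure_union_le _ _
    _ ≤ ε / 2 + ε / 2 := add_le_add hδC hk
    _ = ε := ENNReal.add_halves ε

/-- A simple function of asymptotically measurable events is asymptotically close in `L²` to
functions measurable for the `ℋ k`. -/
theorem simpleFunc_approx_of_le_asympSigma {Ω ι : Type*} {m0 : MeasurableSpace Ω} {P : Measure Ω}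
    [IsProbabilityMeasure P] {l : Filter ι} {ℋ : ι → MeasurableSpace Ω} (hℋ : ∀ k, ℋ k ≤ m0)
    {𝒢 : MeasurableSpace Ω} (h : 𝒢 ≤ asympSigma P l ℋ) (S : @SimpleFunc Ω 𝒢 ℝ)
    {ε : ℝ≥0∞} (hε : ε ≠ 0) :
    ∀ᶠ k in l, ∃ U : Ω → ℝ, StronglyMeasurable[ℋ k] U ∧ MemLp U 2 P ∧
      eLpNorm (⇑S - U) 2 P ≤ ε := by
  induction S using SimpleFunc.induction generalizing ε with
  | @const c A hA =>
    obtain ⟨η, hη, hηε⟩ := exists_eLpNorm_indicator_le (μ := P) (p := 2) ENNReal.ofNat_ne_top c hε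
    filter_upwards [(h A hA).2 η (by exact_mod_cast hη.ne')] with k ⟨A', hA', hP⟩
    refine ⟨A'.indicator fun _ => c, stronglyMeasurable_const.indicator hA',
      (memLp_const c).indicator (hℋ k _ hA'), ?_⟩
    have : (⇑(SimpleFunc.piecewise A hA (SimpleFunc.const Ω c) (SimpleFunc.const Ω 0)) : Ω → ℝ) =
        A.indicator fun _ => c := by
      ext ω
      by_cases hω : ω ∈ A <;> simp [hω]
    rw [this, eLpNorm_indicator_sub_indicator]
    exact hηε _ hP
  | @add f g _ hf hg =>
    have hε2 : ε / 2 ≠ 0 := (ENNReal.half_pos hε).ne'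
    filter_upwards [hf hε2, hg hε2] with k ⟨U, hU, hUL, hUε⟩ ⟨V, hV, hVL, hVε⟩
    refine ⟨U + V, hU.add hV, hUL.add hVL, ?_⟩
    have hle := (h.trans (asympSigma_le P l ℋ))
    have hfm : AEStronglyMeasurable[m0] (⇑f) P :=
      (f.stronglyMeasurable.mono hle).aestronglyMeasurable
    have hgm : AEStronglyMeasurable[m0] (⇑g) P :=
      (g.stronglyMeasurable.mono hle).aestronglyMeasurable
    have : (⇑(f + g) : Ω → ℝ) - (U + V) = (⇑f - U) + (⇑g - V) := by
      ext ω
      simp only [SimpleFunc.coe_add, Pi.sub_apply, Pi.add_apply]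
      ring
    rw [this]
    calc _ ≤ _ := eLpNorm_add_le (hfm.sub hUL.1) (hgm.sub hVL.1) one_le_two
      _ ≤ ε / 2 + ε / 2 := add_le_add hUε hVε
      _ = ε := ENNReal.add_halves ε

/-- If the events of `𝒢` are asymptotically measurable for the `ℋ k`, then in the limit the
estimation error given `ℋ k` is at most the error given `𝒢`. -/
theorem eventually_error_le {Ω ι : Type*} {m0 : MeasurableSpace Ω} {P : Measure Ω}
    [IsProbabilityMeasure P] {l : Filter ι} {ℋ : ι → MeasurableSpace Ω} (hℋ : ∀ k, ℋ k ≤ m0)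
    {𝒢 : MeasurableSpace Ω} (h : 𝒢 ≤ asympSigma P l ℋ) {Z : Ω → ℝ} (hZ : MemLp Z 2 P)
    {ε : ℝ≥0∞} (hε : ε ≠ 0) :
    ∀ᶠ k in l, eLpNorm (Z - P[Z | ℋ k]) 2 P ≤ eLpNorm (Z - P[Z | 𝒢]) 2 P + ε := by
  have h𝒢 : 𝒢 ≤ m0 := h.trans (asympSigma_le P l ℋ)
  have hε2 : ε / 2 ≠ 0 := (ENNReal.half_pos hε).ne'
  set W := P[Z | 𝒢]
  have hWm : StronglyMeasurable[𝒢] W := stronglyMeasurable_condExp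
  have hW : MemLp W 2 P := hZ.condExp one_le_two
  have hWt : MemLp W 2 (P.trim h𝒢) := 
    ⟨hWm.aestronglyMeasurable, by rw [eLpNorm_trim h𝒢 hWm]; exact hW.2⟩
  obtain ⟨S, hS, hSL⟩ := @MemLp.exists_simpleFunc_eLpNorm_sub_lt Ω 𝒢 2 ℝ _ W (P.trim h𝒢) hWt
    ENNReal.ofNat_ne_top _ hε2
  rw [eLpNorm_trim h𝒢 (hWm.sub S.stronglyMeasurable)] at hS
  filter_upwards [simpleFunc_approx_of_le_asympSigma hℋ h S hε2] with k ⟨U, hU, hUL, hUε⟩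
  have hSm : AEStronglyMeasurable[m0] (⇑S) P := (S.stronglyMeasurable.mono h𝒢).aestronglyMeasurable
  have : Z - U = (Z - W) + ((W - ⇑S) + (⇑S - U)) := by
    ext ω
    simp only [Pi.sub_apply, Pi.add_apply]
    ring
  calc eLpNorm (Z - P[Z | ℋ k]) 2 P ≤ eLpNorm (Z - U) 2 P :=
        eLpNorm_sub_condExp_le (hℋ k) hZ hUL hU.aestronglyMeasurable
    _ ≤ eLpNorm (Z - W) 2 P + (eLpNorm (W - ⇑S) 2 P + eLpNorm (⇑S - U) 2 P) := by
        rw [this]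
        refine (eLpNorm_add_le (hZ.1.sub hW.1) ((hW.1.sub hSm).add (hSm.sub hUL.1))
          one_le_two).trans ?_
        gcongr
        exact eLpNorm_add_le (hW.1.sub hSm) (hSm.sub hUL.1) one_le_two
    _ ≤ eLpNorm (Z - W) 2 P + (ε / 2 + ε / 2) := by gcongr
    _ = _ := by rw [ENNReal.add_halves]

/-! ### Joint measurability in time and chance -/

/-- A right continuous process is jointly measurable. -/
theorem measurable_uncurry_of_right_cont {Ω E : Type*} [MeasurableSpace Ω] [TopologicalSpace E]
    [TopologicalSpace.PseudoMetrizableSpace E] [MeasurableSpace E] [BorelSpace E] {X : ℝ → Ω → E}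
    (hX : ∀ t, Measurable (X t))
    (hr : ∀ ω t, ContinuousWithinAt (fun s => X s ω) (Set.Ici t) t) :
    Measurable fun p : ℝ × Ω => X p.1 p.2 := by
  -- sample the path at the next point to the right on a grid of mesh `1 / (N + 1)`
  let τ : ℕ → ℝ → ℝ := fun N t => ((⌊t * (N + 1)⌋ : ℝ) + 1) / (N + 1)
  have hτ1 : ∀ N t, t ≤ τ N t := fun N t => by
    rw [le_div_iff₀ (by positivity)]
    exact (Int.lt_floor_add_one _).le
  have hτ2 : ∀ N t, τ N t ≤ t + 1 / (N + 1) := fun N t => by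
    rw [div_le_iff₀ (by positivity), add_mul, div_mul_cancel₀ _ (by positivity)]
    gcongr
    exact Int.floor_le _
  have hτ : ∀ t, Tendsto (fun N => τ N t) atTop (𝓝[≥] t) := fun t => by
    refine tendsto_nhdsWithin_iff.2 ⟨?_, Eventually.of_forall fun N => hτ1 N t⟩
    refine tendsto_of_tendsto_of_tendsto_of_le_of_le tendsto_const_nhds ?_ (fun N => hτ1 N t)
      (fun N => hτ2 N t)
    simpa using tendsto_const_nhds.add (tendsto_one_div_add_atTop_nhds_zero_nat (𝕜 := ℝ))
  refine measurable_of_tendsto_metrizable (f := fun N (p : ℝ × Ω) => X (τ N p.1) p.2) (fun N => ?_)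
    (tendsto_pi_nhds.2 fun p => (hr p.2 p.1).tendsto.comp (hτ p.1))
  have h1 : Measurable fun q : Ω × ℤ => X (((q.2 : ℝ) + 1) / (N + 1)) q.1 :=
    measurable_from_prod_countable_left fun k => hX (((k : ℝ) + 1) / (N + 1))
  exact h1.comp (measurable_snd.prodMk
    (Int.measurable_floor.comp (measurable_fst.mul_const _)))

/-- Integrals over time of a jointly measurable process are jointly measurable in the endpoint and
the chance variable. -/
theorem measurable_intervalIntegral {Ω F : Type*} [MeasurableSpace Ω] [NormedAddCommGroup F]
    [NormedSpace ℝ F] [MeasurableSpace F] [BorelSpace F] [SecondCountableTopology F]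
    {φ : ℝ → Ω → F} (hφ : Measurable fun p : ℝ × Ω => φ p.1 p.2) (a : ℝ) :
    Measurable fun p : ℝ × Ω => ∫ r in a..p.1, φ r p.2 := by
  simp_rw [intervalIntegral.intervalIntegral_eq_integral_uIoc, ← integral_indicator
    measurableSet_uIoc]
  have hset : MeasurableSet {q : (ℝ × Ω) × ℝ | q.2 ∈ Set.uIoc a q.1.1} := by
    have : {q : (ℝ × Ω) × ℝ | q.2 ∈ Set.uIoc a q.1.1} =
        {q | min a q.1.1 < q.2} ∩ {q | q.2 ≤ max a q.1.1} := rfl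
    rw [this]
    exact (measurableSet_lt (by fun_prop) (by fun_prop)).inter
      (measurableSet_le (by fun_prop) (by fun_prop))
  have hind : Measurable fun q : (ℝ × Ω) × ℝ => (Set.uIoc a q.1.1).indicator
      (fun r => φ r q.1.2) q.2 :=
    (hφ.comp (measurable_snd.prodMk (measurable_snd.comp measurable_fst))).indicator hset
  have hint : StronglyMeasurable fun p : ℝ × Ω =>
      ∫ r, (Set.uIoc a p.1).indicator (fun r => φ r p.2) r :=
    StronglyMeasurable.integral_prod_right (f := fun (p : ℝ × Ω) (r : ℝ) =>
      (Set.uIoc a p.1).indicator (fun r => φ r p.2) r) hind.stronglyMeasurable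
  refine Measurable.smul ?_ hint.measurable
  exact Measurable.ite (measurableSet_le measurable_const measurable_fst) measurable_const
    measurable_const

/-! ### Time integrals of an observed process -/

theorem integral_mul_sub_condExp_eq_zero {Ω : Type*} {ℋ m0 : MeasurableSpace Ω} {P : Measure Ω}
    [IsProbabilityMeasure P] (hℋ : ℋ ≤ m0) {V W : Ω → ℝ}
    (hV : MemLp V 2 P) (hW : MemLp W 2 P) (hWm : StronglyMeasurable[ℋ] W) :
    ∫ ω, W ω * (V - P[V | ℋ]) ω ∂P = 0 := by
  have h1 : Integrable (W * V) P := hW.integrable_mul hV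
  have h2 : Integrable (W * P[V | ℋ]) P := hW.integrable_mul (hV.condExp one_le_two)
  have h3 := condExp_mul_of_stronglyMeasurable_left hWm h1 (hV.integrable one_le_two)
  have h4 : ∫ ω, (W * V) ω ∂P = ∫ ω, (W * P[V | ℋ]) ω ∂P := by
    rw [← integral_condExp hℋ, integral_congr_ae h3]
  have : (fun ω => W ω * (V - P[V | ℋ]) ω) = fun ω => (W * V) ω - (W * P[V | ℋ]) ω := by
    ext ω
    simp only [Pi.sub_apply, Pi.mul_apply]
    ring
  rw [this, integral_sub h1 h2, h4, sub_self]

/-- A time integral of a bounded process whose values are `ℋ`-measurable is `ℋ`-measurable up to a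
null set, although the process need not be jointly measurable for `ℋ` and the Borel sets of the time
axis: by Fubini the time integral `V` is orthogonal to `V - E(V | ℋ)`. -/
theorem aestronglyMeasurable_integral_of_bounded {Ω : Type*} {ℋ m0 : MeasurableSpace Ω}
    {P : Measure Ω} [IsProbabilityMeasure P] (hℋ : ℋ ≤ m0)
    {G : ℝ → Ω → ℝ} (hG : Measurable fun p : ℝ × Ω => G p.1 p.2) {C : ℝ}
    (hC : ∀ r ω, |G r ω| ≤ C) {a b : ℝ} (hab : a ≤ b)
    (hGm : ∀ r ∈ Set.Ioc a b, StronglyMeasurable[ℋ] (G r)) :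
    AEStronglyMeasurable[ℋ] (fun ω => ∫ r in a..b, G r ω) P := by
  set V : Ω → ℝ := fun ω => ∫ r in a..b, G r ω with hVdef
  have hVm : Measurable V :=
    (measurable_intervalIntegral hG a).comp (measurable_const.prodMk measurable_id)
  have hV : MemLp V 2 P := by
    refine MemLp.of_bound hVm.aestronglyMeasurable (C * |b - a|) (Eventually.of_forall fun ω => ?_)
    exact intervalIntegral.norm_integral_le_of_norm_le_const fun r _ => hC r ω
  have hW : MemLp (P[V | ℋ]) 2 P := hV.condExp one_le_two
  set D : Ω → ℝ := V - P[V | ℋ] with hDdef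
  have hD : MemLp D 2 P := hV.sub hW
  have hDint : Integrable D P := hD.integrable one_le_two
  have hGr : ∀ r, Measurable (G r) := fun r => hG.comp (measurable_const.prodMk measurable_id)
  have hVD : ∫ ω, V ω * D ω ∂P = 0 := by
    have hprod : Integrable (Function.uncurry fun (ω : Ω) (r : ℝ) => G r ω * D ω)
        (P.prod (volume.restrict (Set.Ioc a b))) := by
      refine Integrable.bdd_mul (c := C) (hDint.comp_fst _) ?_ ?_
      · exact (hG.comp measurable_swap).aestronglyMeasurable
      · exact Eventually.of_forall fun p => hC p.2 p.1
    calc ∫ ω, V ω * D ω ∂P = ∫ ω, (∫ r in Set.Ioc a b, G r ω * D ω) ∂P := by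
          simp_rw [hVdef, intervalIntegral.integral_of_le hab, integral_mul_const]
      _ = ∫ r in Set.Ioc a b, ∫ ω, G r ω * D ω ∂P := integral_integral_swap hprod
      _ = ∫ r in Set.Ioc a b, 0 := by
          refine setIntegral_congr_fun measurableSet_Ioc fun r hr => ?_
          refine integral_mul_sub_condExp_eq_zero hℋ hV ?_ (hGm r hr)
          exact MemLp.of_bound (hGr r).aestronglyMeasurable C (Eventually.of_forall fun ω => hC r ω)
      _ = 0 := by simp
  have hWD : ∫ ω, (P[V | ℋ]) ω * D ω ∂P = 0 :=
    integral_mul_sub_condExp_eq_zero hℋ hV hW stronglyMeasurable_condExp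
  have hDD : ∫ ω, D ω ^ 2 ∂P = 0 := by
    have : (fun ω => D ω ^ 2) = fun ω => V ω * D ω - (P[V | ℋ]) ω * D ω := by
      ext ω
      simp only [hDdef, Pi.sub_apply]
      ring
    have hi1 : Integrable (fun ω => V ω * D ω) P := hV.integrable_mul hD
    have hi2 : Integrable (fun ω => (P[V | ℋ]) ω * D ω) P := hW.integrable_mul hD
    rw [this, integral_sub hi1 hi2, hVD, hWD, sub_zero]
  have hD0 : (fun ω => D ω ^ 2) =ᵐ[P] 0 :=
    (integral_eq_zero_iff_of_nonneg (fun ω => sq_nonneg _) hD.integrable_sq).1 hDD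
  refine ⟨P[V | ℋ], stronglyMeasurable_condExp, ?_⟩
  filter_upwards [hD0] with ω hω
  have : D ω = 0 := by simpa using hω
  simpa [hDdef, sub_eq_zero] using this

/-- A time integral of a process whose values are `ℋ`-measurable is measurable for the completion
of `ℋ`. -/
theorem comap_integral_le_asympSigma {Ω : Type*} {ℋ m0 : MeasurableSpace Ω}
    {P : Measure Ω} [IsProbabilityMeasure P] (hℋ : ℋ ≤ m0)
    {G : ℝ → Ω → ℝ} (hG : Measurable fun p : ℝ × Ω => G p.1 p.2) {a b : ℝ} (hab : a ≤ b)
    (hGm : ∀ r ∈ Set.Ioc a b, StronglyMeasurable[ℋ] (G r))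
    (hGi : ∀ᵐ ω ∂P, IntervalIntegrable (fun r => G r ω) volume a b)
    {ξ : Ω → ℝ} (hξ : Measurable ξ) (hξG : ∀ᵐ ω ∂P, ξ ω = ∫ r in a..b, G r ω) :
    MeasurableSpace.comap ξ inferInstance ≤ asympSigma P atTop (fun _ : ℕ => ℋ) := by
  -- truncate the process at level `N`
  let T : ℕ → ℝ → ℝ := fun N x => max (-N) (min N x)
  have hT : ∀ N, Measurable (T N) := fun N => by fun_prop
  have hTN : ∀ N x, |T N x| ≤ N := fun N x => by
    have : (0 : ℝ) ≤ N := N.cast_nonneg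
    exact abs_le.2 ⟨le_max_left _ _, max_le (by linarith) (min_le_left _ _)⟩
  have hTx : ∀ N x, |T N x| ≤ |x| := fun N x => by
    have : (0 : ℝ) ≤ N := N.cast_nonneg
    rw [abs_le]
    constructor
    · rcases le_total 0 x with hx | hx
      · exact (by simp : -|x| ≤ 0).trans (le_max_of_le_right (le_min this hx))
      · rw [abs_of_nonpos hx, neg_neg]
        exact le_max_of_le_right (le_min (by linarith) le_rfl)
    · exact max_le (by linarith [abs_nonneg x]) ((min_le_right _ _).trans (le_abs_self x))
  have hTlim : ∀ x, Tendsto (fun N => T N x) atTop (𝓝 x) := fun x => by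
    refine tendsto_const_nhds.congr' ?_
    filter_upwards [eventually_ge_atTop ⌈|x|⌉₊] with N hN
    have hxN : |x| ≤ N := (Nat.le_ceil _).trans (by exact_mod_cast hN)
    obtain ⟨h1, h2⟩ := abs_le.1 hxN
    simp only [T]
    rw [min_eq_right h2, max_eq_right h1]
  have hTG : ∀ N, Measurable fun p : ℝ × Ω => T N (G p.1 p.2) := fun N => (hT N).comp hG
  refine comap_le_asympSigma (U := fun N ω => ∫ r in a..b, T N (G r ω)) hξ (fun N => ?_) ?_
  · exact aestronglyMeasurable_integral_of_bounded hℋ (hTG N) (fun r ω => hTN N _) hab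
      fun r hr => ((hT N).comp (hGm r hr).measurable).stronglyMeasurable
  · refine tendstoInMeasure_of_tendsto_ae (fun N => ?_) ?_
    · exact ((measurable_intervalIntegral (φ := fun r ω => T N (G r ω)) (hTG N) a).comp
        (measurable_const.prodMk measurable_id)).aestronglyMeasurable
    · filter_upwards [hGi, hξG] with ω hω hξω
      rw [hξω]
      refine intervalIntegral.tendsto_integral_filter_of_dominated_convergence
        (fun r => |G r ω|) (Eventually.of_forall fun N => ?_) (Eventually.of_forall fun N => ?_)
        hω.abs ?_
      · exact ((hTG N).comp (measurable_id.prodMk measurable_const)).aestronglyMeasurable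
      · exact Eventually.of_forall fun r _ => hTx N _
      · exact Eventually.of_forall fun r _ => hTlim _

/-! ### Continuity in probability of a stationary right continuous process -/

theorem IsStationaryMarkovCadlag.map_eq {Ω E : Type*} [MeasurableSpace Ω] {P : Measure Ω}
    [TopologicalSpace E] [MeasurableSpace E] {X : ℝ → Ω → E}
    (hX : IsStationaryMarkovCadlag X P) (t : ℝ) : P.map (X t) = P.map (X 0) := by
  have := ((hX.stationary t).comp (measurable_pi_apply (0 : ℝ))).map_eq
  simpa [Function.comp_def] using this

/-- Events that depend on two times only see the lag. -/
theorem IsStationaryMarkovCadlag.measure_symmDiff {Ω E : Type*} [MeasurableSpace Ω]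
    {P : Measure Ω} [TopologicalSpace E] [MeasurableSpace E] {X : ℝ → Ω → E}
    (hX : IsStationaryMarkovCadlag X P) (s t : ℝ) {A : Set E} (hA : MeasurableSet A) :
    P ((X t ⁻¹' A) ∆ (X s ⁻¹' A)) = P ((X (t - s) ⁻¹' A) ∆ (X 0 ⁻¹' A)) := by
  have hm : MeasurableSet (((fun x : ℝ → E => x (t - s)) ⁻¹' A) ∆ ((fun x => x 0) ⁻¹' A)) :=
    (measurable_pi_apply (t - s) hA).symmDiff (measurable_pi_apply (0 : ℝ) hA)
  have := (hX.stationary s).measure_mem_eq hm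
  simpa [Set.preimage_symmDiff, Set.preimage_preimage] using this

/-- For every Borel set `A`, the event `{X_s ∈ A}` depends continuously on `s`. The set `A` is
arbitrary, since its indicator is close to a continuous function in the `L¹` space of the
stationary law, which is the law of every `X_s`. -/
theorem IsStationaryMarkovCadlag.tendsto_measure_symmDiff {Ω E : Type*} [MeasurableSpace Ω]
    {P : Measure Ω} [IsProbabilityMeasure P] [TopologicalSpace E] [PolishSpace E]
    [MeasurableSpace E] [BorelSpace E] {X : ℝ → Ω → E}
    (hX : IsStationaryMarkovCadlag X P) {A : Set E} (hA : MeasurableSet A) :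
    Tendsto (fun u => P ((X u ⁻¹' A) ∆ (X 0 ⁻¹' A))) (𝓝[≥] 0) (𝓝 0) := by
  have hprob : IsProbabilityMeasure (P.map (X 0)) :=
    Measure.isProbabilityMeasure_map (hX.measurable 0).aemeasurable
  rw [ENNReal.tendsto_nhds_zero]
  intro ε hε
  have hε3 : ε / 3 ≠ 0 := ENNReal.div_ne_zero.2 ⟨hε.ne', ENNReal.ofNat_ne_top⟩
  let χ : E → ℝ := A.indicator fun _ => 1
  have hχ : Measurable χ := measurable_const.indicator hA
  have hχL : Integrable χ (P.map (X 0)) := (integrable_const 1).indicator hA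
  obtain ⟨φ, hφ, -⟩ := hχL.exists_boundedContinuous_lintegral_sub_le hε3
  have hφm : Measurable φ := φ.continuous.measurable
  have hlaw : ∀ u, ∫⁻ ω, ‖χ (X u ω) - φ (X u ω)‖ₑ ∂P ≤ ε / 3 := fun u => by
    rw [← lintegral_map (f := fun x => ‖χ x - φ x‖ₑ) (hχ.sub hφm).enorm (hX.measurable u),
      hX.map_eq u]
    exact hφ
  have hcont : Tendsto (fun u => ∫⁻ ω, ‖φ (X u ω) - φ (X 0 ω)‖ₑ ∂P) (𝓝[≥] 0) (𝓝 0) := by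
    have h0 : (0 : ℝ≥0∞) = ∫⁻ _, 0 ∂P := by simp
    rw [h0]
    refine tendsto_lintegral_filter_of_dominated_convergence (fun _ => ENNReal.ofReal (2 * ‖φ‖))
      (Eventually.of_forall fun u => ?_) (Eventually.of_forall fun u => ?_) ?_ ?_
    · exact ((hφm.comp (hX.measurable u)).sub (hφm.comp (hX.measurable 0))).enorm
    · refine Eventually.of_forall fun ω => ?_
      rw [← ofReal_norm, ← dist_eq_norm]
      exact ENNReal.ofReal_le_ofReal (φ.dist_le_two_norm _ _)
    · rw [lintegral_const, measure_univ, mul_one]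
      exact ENNReal.ofReal_ne_top
    · refine Eventually.of_forall fun ω => ?_
      have h1 : Tendsto (fun u => φ (X u ω) - φ (X 0 ω)) (𝓝[≥] 0) (𝓝 (φ (X 0 ω) - φ (X 0 ω))) :=
        ((φ.continuous.tendsto _).comp (hX.right_cont ω 0).tendsto).sub_const _
      simpa using h1.enorm
  filter_upwards [(ENNReal.tendsto_nhds_zero.1 hcont) (ε / 3) (pos_iff_ne_zero.2 hε3)] with u hu
  have hint : P ((X u ⁻¹' A) ∆ (X 0 ⁻¹' A)) ≤ ∫⁻ ω, ‖χ (X u ω) - χ (X 0 ω)‖ₑ ∂P := by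
    rw [← lintegral_indicator_one ((hX.measurable u hA).symmDiff (hX.measurable 0 hA))]
    refine lintegral_mono fun ω => ?_
    by_cases h1 : X u ω ∈ A <;> by_cases h2 : X 0 ω ∈ A <;>
      simp [χ, Set.mem_symmDiff, h1, h2]
  have htri : ∀ ω, ‖χ (X u ω) - χ (X 0 ω)‖ₑ ≤ ‖χ (X u ω) - φ (X u ω)‖ₑ +
      ‖φ (X u ω) - φ (X 0 ω)‖ₑ + ‖χ (X 0 ω) - φ (X 0 ω)‖ₑ := fun ω => by
    have : χ (X u ω) - χ (X 0 ω) = (χ (X u ω) - φ (X u ω)) + (φ (X u ω) - φ (X 0 ω)) -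
      (χ (X 0 ω) - φ (X 0 ω)) := by ring
    rw [this]
    exact enorm_sub_le.trans (add_le_add_left (enorm_add_le _ _) _)
  have hm1 : ∀ u, Measurable fun ω => ‖χ (X u ω) - φ (X u ω)‖ₑ := fun u =>
    ((hχ.sub hφm).comp (hX.measurable u)).enorm
  calc P ((X u ⁻¹' A) ∆ (X 0 ⁻¹' A)) ≤ _ := hint
    _ ≤ _ := lintegral_mono htri
    _ = ∫⁻ ω, ‖χ (X u ω) - φ (X u ω)‖ₑ ∂P + ∫⁻ ω, ‖φ (X u ω) - φ (X 0 ω)‖ₑ ∂P +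
        ∫⁻ ω, ‖χ (X 0 ω) - φ (X 0 ω)‖ₑ ∂P := by
        rw [lintegral_add_right _ (hm1 0), lintegral_add_left (hm1 u)]
    _ ≤ ε / 3 + ε / 3 + ε / 3 := by
        gcongr
        exacts [hlaw u, hlaw 0]
    _ = ε := ENNReal.add_thirds ε

/-! ### The noiseless observations and the observed signal -/

section Observations

variable {Ω E : Type*} {n : ℕ}

theorem measurable_of_coord {m : MeasurableSpace Ω} {ξ : Ω → EuclideanSpace ℝ (Fin n)}
    (hξ : ∀ i, Measurable fun ω => ξ ω i) : Measurable ξ :=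
  (WithLp.measurable_toLp 2 _).comp (measurable_pi_lambda (fun ω i => ξ ω i) hξ)

theorem measurable_sigmaOn {F : Type*} [MeasurableSpace F] {X : ℝ → Ω → F} {I : Set ℝ} {t : ℝ}
    (ht : t ∈ I) : Measurable[sigmaOn X I] (X t) :=
  measurable_iff_comap_le.2
    (le_iSup₂ (f := fun s (_ : s ∈ I) => MeasurableSpace.comap (X s) inferInstance) t ht)

theorem sigmaOn_le {F : Type*} [MeasurableSpace F] {X : ℝ → Ω → F} {I : Set ℝ}
    {m : MeasurableSpace Ω} (h : ∀ t ∈ I, Measurable[m] (X t)) : sigmaOn X I ≤ m :=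
  iSup₂_le fun t ht => (h t ht).comap_le

theorem measurable_incr_pastIncrSigma {Y : ℝ → Ω → EuclideanSpace ℝ (Fin n)} {a s b : ℝ}
    (hab : a < b) (has : a ≤ s) (hsb : s ≤ b) :
    Measurable[pastIncrSigma Y b] fun ω => Y s ω - Y a ω :=
  (measurable_sigmaOn (X := fun s ω => Y s ω - Y a ω) (I := Set.Icc a b) ⟨has, hsb⟩).mono
    (le_iSup₂ (f := fun a (_ : a ∈ Set.Iio b) => incrSigma Y a b) a hab) le_rfl

theorem pastIncrSigma_le {Y : ℝ → Ω → EuclideanSpace ℝ (Fin n)} {b : ℝ} {m : MeasurableSpace Ω}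
    (h : ∀ a s, a < b → a ≤ s → s ≤ b → Measurable[m] fun ω => Y s ω - Y a ω) :
    pastIncrSigma Y b ≤ m :=
  iSup₂_le fun a ha => sigmaOn_le fun s hs => h a s ha hs.1 hs.2

theorem obs_zero (X : ℝ → Ω → E) (B : ℝ → Ω → EuclideanSpace ℝ (Fin n))
    (h : E → EuclideanSpace ℝ (Fin n)) (t : ℝ) :
    obs X B h 0 t = fun ω => ∫ s in (0 : ℝ)..t, h (X s ω) := by
  ext1 ω
  simp [obs]

theorem obs_eq_add (X : ℝ → Ω → E) (B : ℝ → Ω → EuclideanSpace ℝ (Fin n))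
    (h : E → EuclideanSpace ℝ (Fin n)) (κ t : ℝ) (ω : Ω) :
    obs X B h κ t ω = obs X B h 0 t ω + κ • B t ω := by
  simp [obs]

variable [TopologicalSpace E] [PolishSpace E] [MeasurableSpace E] [BorelSpace E]
  {X : ℝ → Ω → E} {h : E → EuclideanSpace ℝ (Fin n)}

/-- The noiseless observations are measurable for any σ-field for which the signal is. -/
theorem measurable_obs_zero [MeasurableSpace Ω] (hX : ∀ t, Measurable (X t))
    (hr : ∀ ω t, ContinuousWithinAt (fun s => X s ω) (Set.Ici t) t) (hh : Measurable h)
    (B : ℝ → Ω → EuclideanSpace ℝ (Fin n)) :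
    Measurable fun p : ℝ × Ω => obs X B h 0 p.1 p.2 := by
  simp_rw [obs_zero]
  exact measurable_intervalIntegral (φ := fun r ω => h (X r ω))
    (hh.comp (measurable_uncurry_of_right_cont hX hr)) 0

/-- Up to null sets, the noiseless observations carry no more information than `h(X_s)`,
`s ≤ 0`. -/
theorem pastIncrSigma_obs_zero_le [MeasurableSpace Ω] {P : Measure Ω} [IsProbabilityMeasure P]
    (hX : IsStationaryMarkovCadlag X P) (hh : Measurable h)
    (hint : ∀ᵐ ω ∂P, LocallyIntegrable (fun s : ℝ => h (X s ω)) volume)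
    (B : ℝ → Ω → EuclideanSpace ℝ (Fin n)) :
    pastIncrSigma (obs X B h 0) 0 ≤
      asympSigma P atTop (fun _ : ℕ => sigmaOn (fun s ω => h (X s ω)) (Set.Iic 0)) := by
  have hjoint := hh.comp (measurable_uncurry_of_right_cont hX.measurable hX.right_cont)
  have hobs := measurable_obs_zero hX.measurable hX.right_cont hh B
  have hle := sigmaOn_le (X := fun s ω => h (X s ω)) (I := Set.Iic 0)
    fun t _ => hh.comp (hX.measurable t)
  suffices H : ∀ t ≤ 0, Measurable[asympSigma P atTop
      (fun _ : ℕ => sigmaOn (fun s ω => h (X s ω)) (Set.Iic 0))] (obs X B h 0 t) from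
    pastIncrSigma_le fun a s ha _ hs => (H s hs).sub (H a ha.le)
  intro t ht
  suffices H : ∀ i, Measurable[asympSigma P atTop
      (fun _ : ℕ => sigmaOn (fun s ω => h (X s ω)) (Set.Iic 0))] fun ω => obs X B h 0 t ω i from
    measurable_of_coord H
  intro i
  refine measurable_iff_comap_le.2 (comap_integral_le_asympSigma hle
    (G := fun r ω => -(h (X r ω) i)) (a := t) (b := 0) ?_ ht ?_ ?_ ?_ ?_)
  · exact ((EuclideanSpace.proj (𝕜 := ℝ) i).continuous.measurable.comp hjoint).neg
  · intro r hr
    refine Measurable.stronglyMeasurable ?_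
    exact ((EuclideanSpace.proj (𝕜 := ℝ) i).continuous.measurable.comp
      (measurable_sigmaOn (X := fun s ω => h (X s ω)) (I := Set.Iic 0) hr.2)).neg
  · filter_upwards [hint] with ω hω
    have := (hω.integrableOn_isCompact (isCompact_uIcc (a := t) (b := 0))).mono_set
      Set.uIoc_subset_uIcc
    exact (intervalIntegrable_iff.2 ((EuclideanSpace.proj (𝕜 := ℝ) i).integrable_comp this)).neg
  · exact (EuclideanSpace.proj (𝕜 := ℝ) i).continuous.measurable.comp
      (hobs.comp (measurable_const.prodMk measurable_id))
  · filter_upwards [hint] with ω hω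
    have := (hω.integrableOn_isCompact (isCompact_uIcc (a := 0) (b := t))).mono_set
      Set.uIoc_subset_uIcc
    rw [obs_zero, intervalIntegral.integral_neg, ← intervalIntegral.integral_symm]
    exact ((EuclideanSpace.proj (𝕜 := ℝ) i).intervalIntegral_comp_comm
      (intervalIntegrable_iff.2 this)).symm

/-- By Lebesgue's differentiation theorem, for almost every time `t ≤ 0` the variable `h(X_t)` is
determined by the noiseless observations, up to null sets. -/
theorem ae_comap_le_asympSigma [MeasurableSpace Ω] {P : Measure Ω} [IsProbabilityMeasure P]
    (hX : IsStationaryMarkovCadlag X P) (hh : Measurable h)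
    (hint : ∀ᵐ ω ∂P, LocallyIntegrable (fun s : ℝ => h (X s ω)) volume)
    (B : ℝ → Ω → EuclideanSpace ℝ (Fin n)) :
    ∀ᵐ t : ℝ, t ≤ 0 → MeasurableSpace.comap (fun ω => h (X t ω)) inferInstance ≤
      asympSigma P atTop (fun _ : ℕ => pastIncrSigma (obs X B h 0) 0) := by
  have hjoint := hh.comp (measurable_uncurry_of_right_cont hX.measurable hX.right_cont)
  have hobs := measurable_obs_zero hX.measurable hX.right_cont hh B
  let Q : ℕ → ℝ → Ω → EuclideanSpace ℝ (Fin n) := fun N t ω =>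
    ((N : ℝ) + 1) • (obs X B h 0 t ω - obs X B h 0 (t - 1 / (N + 1)) ω)
  have hQ : ∀ N, Measurable fun p : ℝ × Ω => Q N p.1 p.2 := fun N =>
    (hobs.sub (hobs.comp ((measurable_fst.sub_const (1 / ((N : ℝ) + 1))).prodMk
      measurable_snd))).const_smul ((N : ℝ) + 1)
  have hset : MeasurableSet {p : ℝ × Ω | Tendsto (fun N => Q N p.1 p.2) atTop
      (𝓝 (h (X p.1 p.2)))} := measurableSet_tendsto_fun hQ hjoint
  have hω : ∀ᵐ ω ∂P, ∀ᵐ t : ℝ, Tendsto (fun N => Q N t ω) atTop (𝓝 (h (X t ω))) := by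
    filter_upwards [hint] with ω hω
    filter_upwards [_root_.LocallyIntegrable.ae_hasDerivAt_integral hω] with t ht
    have hlim : Tendsto (fun N : ℕ => t - 1 / ((N : ℝ) + 1)) atTop (𝓝[≠] t) := by
      refine tendsto_nhdsWithin_iff.2 ⟨?_, Eventually.of_forall fun N => ?_⟩
      · simpa using (tendsto_one_div_add_atTop_nhds_zero_nat (𝕜 := ℝ)).const_sub t
      · have : (0 : ℝ) < 1 / ((N : ℝ) + 1) := by positivity
        exact (sub_lt_self t this).ne
    refine ((hasDerivAt_iff_tendsto_slope.1 (ht 0)).comp hlim).congr fun N => ?_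
    simp only [Q, obs_zero, Function.comp_apply, slope, vsub_eq_sub]
    rw [sub_sub_cancel_left, one_div, inv_neg, inv_inv, neg_smul, ← smul_neg, neg_sub]
  filter_upwards [(Measure.ae_ae_comm hset).2 hω] with t ht ht0
  refine comap_le_asympSigma (U := fun N => Q N t) (hh.comp (hX.measurable t)) (fun N => ?_)
    (tendstoInMeasure_of_tendsto_ae (fun N => ?_) ht)
  · have hN : (0 : ℝ) < 1 / ((N : ℝ) + 1) := by positivity
    have : Measurable[pastIncrSigma (obs X B h 0) 0] (Q N t) :=
      (measurable_incr_pastIncrSigma (a := t - 1 / ((N : ℝ) + 1)) (by linarith) (by linarith)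
        ht0).const_smul ((N : ℝ) + 1)
    exact this.stronglyMeasurable.aestronglyMeasurable
  · exact ((hQ N).comp (measurable_const.prodMk measurable_id)).aestronglyMeasurable

/-- Up to null sets, the noiseless observations determine `h(X_s)` for every `s ≤ 0`, not only for
almost every one. -/
theorem sigmaOn_le_asympSigma [MeasurableSpace Ω] {P : Measure Ω} [IsProbabilityMeasure P]
    (hX : IsStationaryMarkovCadlag X P) (hh : Measurable h)
    (hint : ∀ᵐ ω ∂P, LocallyIntegrable (fun s : ℝ => h (X s ω)) volume)
    (B : ℝ → Ω → EuclideanSpace ℝ (Fin n)) :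
    sigmaOn (fun s ω => h (X s ω)) (Set.Iic 0) ≤
      asympSigma P atTop (fun _ : ℕ => pastIncrSigma (obs X B h 0) 0) := by
  refine iSup₂_le fun t ht => ?_
  have ht : t ≤ 0 := ht
  rintro _ ⟨C, hC, rfl⟩
  have hA : MeasurableSet (h ⁻¹' C) := hh hC
  refine ⟨hX.measurable t hA, fun ε hε => Eventually.of_forall fun _ => ?_⟩
  have hε2 : ε / 2 ≠ 0 := (ENNReal.half_pos hε).ne'
  -- an earlier time, close to `t`, at which the signal is determined by the observations
  obtain ⟨s, hst, hs, hsC⟩ : ∃ s, s ≤ t ∧ P ((X t ⁻¹' (h ⁻¹' C)) ∆ (X s ⁻¹' (h ⁻¹' C))) ≤ ε / 2 ∧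
      MeasurableSpace.comap (fun ω => h (X s ω)) inferInstance ≤
      asympSigma P atTop (fun _ : ℕ => pastIncrSigma (obs X B h 0) 0) := by
    have h1 := (ENNReal.tendsto_nhds_zero.1 (hX.tendsto_measure_symmDiff hA)) (ε / 2)
      (pos_iff_ne_zero.2 hε2)
    obtain ⟨δ, hδ, hδA⟩ := (mem_nhdsGE_iff_exists_Ico_subset).1 h1
    have hδ : 0 < δ := hδ
    have hvol : volume (Set.Ioo (t - δ) t) ≠ 0 := by simp [hδ]
    obtain ⟨s, ⟨hs1, hs2⟩, hs3⟩ := ((frequently_ae_mem_iff.2 hvol).and_eventually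
      (ae_comap_le_asympSigma hX hh hint B)).exists
    refine ⟨s, hs2.le, ?_, hs3 (hs2.le.trans ht)⟩
    rw [hX.measure_symmDiff s t hA]
    exact hδA ⟨by linarith, by linarith⟩
  obtain ⟨-, hs'⟩ := hsC _ ⟨C, hC, rfl⟩
  obtain ⟨_, A', hA', hP⟩ := (hs' _ hε2).exists
  refine ⟨A', hA', ?_⟩
  calc P (_ ∆ A') ≤ P ((X t ⁻¹' (h ⁻¹' C)) ∆ (X s ⁻¹' (h ⁻¹' C))) +
        P ((X s ⁻¹' (h ⁻¹' C)) ∆ A') := measure_symmDiff_le _ _ _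
    _ ≤ ε / 2 + ε / 2 := add_le_add hs hP
    _ = ε := ENNReal.add_halves ε

end Observations

/-! ### Noisy observations -/

section Noise

variable {Ω E : Type*} {n : ℕ} {X : ℝ → Ω → E} {B : ℝ → Ω → EuclideanSpace ℝ (Fin n)}
  {h : E → EuclideanSpace ℝ (Fin n)}

/-- The noisy observations are functions of the noiseless ones and the noise. -/
theorem pastIncrSigma_obs_le_sup (X : ℝ → Ω → E) (h : E → EuclideanSpace ℝ (Fin n))
    {𝒦 : MeasurableSpace Ω} (hB : ∀ t, Measurable (B t)) (κ : ℝ) :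
    pastIncrSigma (obs X B h κ) 0 ≤ pastIncrSigma (obs X B h 0) 0 ⊔ 𝒦 := by
  refine pastIncrSigma_le fun a s ha has hs => ?_
  have heq : (fun ω => obs X B h κ s ω - obs X B h κ a ω) = fun ω =>
      (obs X B h 0 s ω - obs X B h 0 a ω) + κ • (B s ω - B a ω) := by
    ext1 ω
    rw [obs_eq_add X B h κ s, obs_eq_add X B h κ a, smul_sub]
    abel
  rw [heq]
  exact ((measurable_incr_pastIncrSigma ha has hs).mono le_sup_left le_rfl).add
    ((((hB s).sub (hB a)).const_smul κ).mono le_sup_right le_rfl)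

variable [TopologicalSpace E] [PolishSpace E] [MeasurableSpace E] [BorelSpace E]

theorem pastIncrSigma_obs_zero_le_signal {ℳ : MeasurableSpace Ω} (hX : ∀ t, Measurable (X t))
    (hr : ∀ ω t, ContinuousWithinAt (fun s => X s ω) (Set.Ici t) t) (hh : Measurable h)
    (B : ℝ → Ω → EuclideanSpace ℝ (Fin n)) : pastIncrSigma (obs X B h 0) 0 ≤ ℳ := by
  have hobs := measurable_obs_zero hX hr hh B
  have hobs_t : ∀ t, Measurable (obs X B h 0 t) := fun t =>
    Measurable.of_uncurry_left (f := obs X B h 0) hobs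
  exact pastIncrSigma_le fun a s _ _ _ => (hobs_t s).sub (hobs_t a)

theorem measurable_obs {m0 : MeasurableSpace Ω} {P : Measure Ω} (hX : IsStationaryMarkovCadlag X P) (hB : ∀ t, Measurable (B t))
    (hh : Measurable h) (κ t : ℝ) : Measurable (obs X B h κ t) := by
  have : obs X B h κ t = fun ω => obs X B h 0 t ω + κ • B t ω := funext (obs_eq_add X B h κ t)
  rw [this]
  exact ((measurable_obs_zero hX.measurable hX.right_cont hh B).comp
    (measurable_const.prodMk measurable_id)).add ((hB t).const_smul κ)

theorem pastIncrSigma_obs_le {m0 : MeasurableSpace Ω} {P : Measure Ω}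
    (hX : IsStationaryMarkovCadlag X P) (hB : ∀ t, Measurable (B t))
    (hh : Measurable h) (κ : ℝ) : pastIncrSigma (obs X B h κ) 0 ≤ m0 :=
  pastIncrSigma_le fun a s _ _ _ => (measurable_obs hX hB hh κ s).sub (measurable_obs hX hB hh κ a)

/-- As the noise vanishes, the noisy observations approximate the noiseless ones. -/
theorem pastIncrSigma_obs_zero_le_asympSigma {m0 : MeasurableSpace Ω} {P : Measure Ω}
    [IsProbabilityMeasure P] (hX : IsStationaryMarkovCadlag X P)
    (hB : ∀ t, Measurable (B t)) (hh : Measurable h) :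
    pastIncrSigma (obs X B h 0) 0 ≤
      asympSigma P (𝓝[>] (0 : ℝ)) fun κ => pastIncrSigma (obs X B h κ) 0 := by
  have hobs := measurable_obs hX hB hh
  refine pastIncrSigma_le fun a s ha has hs => measurable_iff_comap_le.2 ?_
  refine comap_le_asympSigma (U := fun κ ω => obs X B h κ s ω - obs X B h κ a ω)
    ((hobs 0 s).sub (hobs 0 a))
    (fun κ => (measurable_incr_pastIncrSigma ha has hs).stronglyMeasurable.aestronglyMeasurable) ?_
  intro ε hε
  refine tendsto_of_seq_tendsto fun κ hκ => ?_
  refine tendstoInMeasure_of_tendsto_ae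
    (fun N => ((hobs (κ N) s).sub (hobs (κ N) a)).aestronglyMeasurable)
    (Eventually.of_forall fun ω => ?_) ε hε
  have hκ0 : Tendsto κ atTop (𝓝 0) := hκ.mono_right nhdsWithin_le_nhds
  have : ∀ t, Tendsto (fun N => obs X B h (κ N) t ω) atTop (𝓝 (obs X B h 0 t ω)) := fun t => by
    simp_rw [obs_eq_add X B h (κ _) t ω]
    simpa using (hκ0.smul_const (B t ω)).const_add (obs X B h 0 t ω)
  exact (this s).sub (this a)

/-- Independent noise cannot help: noisy observations never give a smaller error than noiseless
ones, since revealing the whole noise in addition to the noiseless observations does not change the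
conditional expectation. The σ-fields `ℳ` and `𝒦` carry the signal and the noise. -/
theorem error_noiseless_le {ℳ 𝒦 m0 : MeasurableSpace Ω} {P : Measure Ω} [IsProbabilityMeasure P]
    (hℳ : ℳ ≤ m0) (h𝒦 : 𝒦 ≤ m0) (hind : Indep ℳ 𝒦 P) (hX : ∀ t, Measurable[ℳ] (X t))
    (hr : ∀ ω t, ContinuousWithinAt (fun s => X s ω) (Set.Ici t) t)
    (hB : ∀ t, Measurable[𝒦] (B t)) (hh : Measurable h)
    {f : E → ℝ} (hf : MemLp f 2 (P.map (X 0))) (κ : ℝ) :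
    eLpNorm ((fun ω => f (X 0 ω)) - P[fun ω => f (X 0 ω) | pastIncrSigma (obs X B h 0) 0]) 2 P ≤
      eLpNorm ((fun ω => f (X 0 ω)) - P[fun ω => f (X 0 ω) | pastIncrSigma (obs X B h κ) 0]) 2
        P := by
  have h𝒢ℳ : pastIncrSigma (obs X B h 0) 0 ≤ ℳ := pastIncrSigma_obs_zero_le_signal hX hr hh B
  have hX0 : Measurable (X 0) := (hX 0).mono hℳ le_rfl
  -- replace `f` by a Borel version
  let g : E → ℝ := hf.1.mk f
  have hg : StronglyMeasurable g := hf.1.stronglyMeasurable_mk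
  have hfg : (fun ω => f (X 0 ω)) =ᵐ[P] fun ω => g (X 0 ω) :=
    ae_of_ae_map hX0.aemeasurable hf.1.ae_eq_mk
  have hZ : MemLp (fun ω => g (X 0 ω)) 2 P :=
    ((memLp_map_measure_iff hf.1 hX0.aemeasurable).1 hf).ae_eq hfg
  have hcong : ∀ 𝒢 : MeasurableSpace Ω, eLpNorm ((fun ω => f (X 0 ω)) -
      P[fun ω => f (X 0 ω) | 𝒢]) 2 P =
      eLpNorm ((fun ω => g (X 0 ω)) - P[fun ω => g (X 0 ω) | 𝒢]) 2 P := fun 𝒢 =>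
    eLpNorm_congr_ae (hfg.sub (condExp_congr_ae hfg))
  have hsup := condExp_sup_of_indep hℳ h𝒦 h𝒢ℳ hind (hZ.integrable one_le_two)
    (hg.measurable.comp (hX 0)).stronglyMeasurable
  rw [hcong, hcong, eLpNorm_congr_ae (EventuallyEq.rfl.sub hsup)]
  exact eLpNorm_sub_condExp_anti (pastIncrSigma_obs_le_sup X h hB κ)
    (sup_le (h𝒢ℳ.trans hℳ) h𝒦) hZ

end Noise

end FilterAccuracy

theorem lemma3p2
    {Ω : Type*} [MeasurableSpace Ω] (P : Measure Ω) [IsProbabilityMeasure P]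
    {E : Type*} [TopologicalSpace E] [PolishSpace E] [MeasurableSpace E] [BorelSpace E]
    {n : ℕ} (X : ℝ → Ω → E) (B : ℝ → Ω → EuclideanSpace ℝ (Fin n))
    (h : E → EuclideanSpace ℝ (Fin n))
    (hX : FilterAccuracy.IsStationaryMarkovCadlag X P)
    (hB : FilterAccuracy.IsTwoSidedWiener B P)
    (hXB : IndepFun (fun ω t => X t ω) (fun ω t => B t ω) P)
    (hh : Measurable h)
    (hint : ∀ᵐ ω ∂P, LocallyIntegrable (fun s : ℝ => h (X s ω)) volume)
    (f : E → ℝ) (hf : MemLp f 2 (P.map (X 0))) :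
    Tendsto (fun κ : ℝ => FilterAccuracy.filterError P X B h f κ) (𝓝[>] 0)
        (𝓝 (FilterAccuracy.filterError P X B h f 0)) ∧
      FilterAccuracy.filterError P X B h f 0 = FilterAccuracy.noiselessError P X h f := by
  have hBm := hB.measurable
  have hZ : MemLp (fun ω => f (X 0 ω)) 2 P :=
    (memLp_map_measure_iff hf.1 (hX.measurable 0).aemeasurable).1 hf
  have hG := fun κ => FilterAccuracy.pastIncrSigma_obs_le hX hBm hh κ
  have hH := FilterAccuracy.sigmaOn_le (X := fun s ω => h (X s ω)) (I := Set.Iic 0)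
    fun t _ => hh.comp (hX.measurable t)
  simp only [FilterAccuracy.filterError, FilterAccuracy.noiselessError,
    FilterAccuracy.condError_eq_eLpNorm hZ]
  constructor
  · refine ((ENNReal.tendsto_toReal (hZ.sub (hZ.condExp one_le_two)).2.ne).comp ?_).pow 2
    rw [ENNReal.tendsto_nhds (hZ.sub (hZ.condExp one_le_two)).2.ne]
    intro ε hε
    filter_upwards [FilterAccuracy.eventually_error_le hG
      (FilterAccuracy.pastIncrSigma_obs_zero_le_asympSigma hX hBm hh) hZ hε.ne'] with κ hκ
    exact ⟨tsub_le_self.trans (FilterAccuracy.error_noiseless_le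
      (measurable_pi_lambda _ hX.measurable).comap_le (measurable_pi_lambda _ hBm).comap_le hXB
      (fun t => (measurable_pi_apply t).comp (comap_measurable fun ω t => X t ω)) hX.right_cont
      (fun t => (measurable_pi_apply t).comp (comap_measurable fun ω t => B t ω)) hh hf κ), hκ⟩
  · congr 2
    refine le_antisymm (ENNReal.le_of_forall_pos_le_add fun ε hε _ => ?_)
      (ENNReal.le_of_forall_pos_le_add fun ε hε _ => ?_)
    · exact (FilterAccuracy.eventually_error_le (fun _ => hG 0)
        (FilterAccuracy.sigmaOn_le_asympSigma hX hh hint B) hZ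
        (by exact_mod_cast hε.ne')).exists.choose_spec
    · exact (FilterAccuracy.eventually_error_le (fun _ => hH)
        (FilterAccuracy.pastIncrSigma_obs_zero_le hX hh hint B) hZ
        (by exact_mod_cast hε.ne')).exists.choose_spec
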